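/- For $x\in\mathbb R^d$, $z=(x,\xi)\in\mathbb R^{2d}$ write $\langle z\rangle=(1+|z|^2)^{1/2}$. For $m\in\mathbb R$ let $G_h^m$ be the set of functions $a=a(z;h)\in C^\infty(\mathbb R^{2d}\times(0,1])$ such that for every $\alpha\in\mathbb N^{2d}$ there is $C_\alpha>0$ with $$|\partial_z^\alpha a(z;h)|\le C_\alpha\,h^{|\alpha|}\langle hz\rangle^{m-|\alpha|},\qquad z\in\mathbb R^{2d},\ h\in(0,1],$$ and write $a\sim 0$ if $a\in\bigcap_{k\in\mathbb N}h^kG_h^{-k}$. For a symbol $b$ on $\mathbb R^{2d}$ the Weyl quantization is $$b^w(x,D)g(x)=(2\pi)^{-d}\int_{\mathbb R^d}\int_{\mathbb R^d}e^{i(x-y)\cdot\xi}\,b\big(\tfrac{x+y}2,\xi\big)\,g(y)\,dy\,d\xi,\qquad g\in\mathscr S(\mathbb R^d),$$ extended by duality to $\mathscr S'(\mathbb R^d)$, i.e. $\langle b^w(x,D)u,g\rangle=\langle u,{}^t b^w(x,D)g\rangle$, where ${}^t b^w(x,D)$ is the formal transpose on $\mathscr S(\mathbb R^d)$. **Proposition.**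 Let $u\in\mathscr S'(\mathbb R^d)$ and $a\sim 0$. Then for every $h\in(0,1]$ the operator $a^w(x,D)$ with symbol $a(\cdot\,;h)$ is well defined and continuous on $\mathscr S(\mathbb R^d)$ and, by duality, on $\mathscr S'(\mathbb R^d)$, one has $a^w(x,D)u\in L^2(\mathbb R^d)$, and $$\|a^w(x,D)u\|_{L^2}=\mathcal O(h^\infty),$$ that is, for every $N\in\mathbb N$ there is a constant $C$ (depending on $u$, $a$, $N$ but not on $h$) such that $\|a^w(x,D)u\|_{L^2}\le C\,h^N$ for all $h\in(0,1]$. -/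

import Mathlib

open MeasureTheory Set
open scoped SchwartzMap ContDiff InnerProductSpace

noncomputable section

/-- The Euclidean space `ℝ^d`. -/
abbrev Rd (d : ℕ) : Type := EuclideanSpace ℝ (Fin d)

/-- The phase space `ℝ^{2d} = T^*(ℝ^d)`, with points `z = (x, ξ)`. -/
abbrev PhaseSpace (d : ℕ) : Type := Rd d × Rd d

/-- The bracket `⟨z⟩ = (1 + |z|²)^{1/2}` with the Euclidean `|z|² = |x|² + |ξ|²`, `z = (x, ξ)`
(the norm that the product type itself carries is the maximum norm). -/
def japBracket {d : ℕ} (z : PhaseSpace d) : ℝ :=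
  Real.sqrt (1 + (‖z.1‖ ^ 2 + ‖z.2‖ ^ 2))

/-- The class `G_h^m` of `h`-Shubin symbols of order `m`; the symbol `a(z;h)` is written `a h z`,
and only its values for `h ∈ (0,1]` matter. The symbol is smooth on `ℝ^{2d} × (0,1]` and all its
derivatives of order `n` in `z` are bounded by `C_n h^n ⟨hz⟩^{m-n}`, uniformly in `z` and `h`
(up to the value of `C_n`, bounding the norm of the `n`-th derivative is bounding all partial
derivatives `∂^α_z a` with `|α| = n`). -/
def HShubin (d : ℕ) (m : ℝ) : Set (ℝ → PhaseSpace d → ℂ) :=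
  {a | ContDiffOn ℝ ∞ (fun p : PhaseSpace d × ℝ => a p.2 p.1) (univ ×ˢ Ioc (0 : ℝ) 1) ∧
    ∀ n : ℕ, ∃ C : ℝ, ∀ h ∈ Ioc (0 : ℝ) 1, ∀ z : PhaseSpace d,
      ‖iteratedFDeriv ℝ n (a h) z‖ ≤ C * h ^ n * japBracket (h • z) ^ (m - n)}

/-- `a ∼ 0`, that is, `a ∈ ⋂_k h^k G_h^{-k}`. -/
def IsNegligibleSymbol {d : ℕ} (a : ℝ → PhaseSpace d → ℂ) : Prop :=
  ∀ k : ℕ, ∃ b ∈ HShubin d (-(k : ℝ)), ∀ h ∈ Ioc (0 : ℝ) 1, ∀ z : PhaseSpace d,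
    a h z = (h : ℂ) ^ k * b h z

/-- The Weyl quantization formula
`(2π)^{-d} ∫∫ e^{i(x-y)·ξ} a((x+y)/2, ξ) g(y) dy dξ`.
For a Shubin symbol of order `m < -d` and `g ∈ 𝓢(ℝ^d)` the double integral converges absolutely.
For a Shubin symbol of any order, the inner integral in `y` converges absolutely and decays
rapidly in `ξ`, so that the iterated integral is the value of the oscillatory integral. -/
def weylIntegral {d : ℕ} (a : PhaseSpace d → ℂ) (g : Rd d → ℂ) (x : Rd d) : ℂ :=
  (((2 * Real.pi) ^ d)⁻¹ : ℝ) *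
    ∫ ξ : Rd d, ∫ y : Rd d,
      Complex.exp (Complex.I * ((⟪x - y, ξ⟫_ℝ : ℝ) : ℂ)) * a ((2⁻¹ : ℝ) • (x + y), ξ) * g y

/-- `A` is the operator `a^w(x,D)` on `𝓢'(ℝ^d)`: the Weyl formula defines a continuous operator `T`
on `𝓢(ℝ^d)`, it has a continuous formal transpose `Tt` on `𝓢(ℝ^d)`, and `A` is the extension of `T`
by duality, `⟨A u, g⟩ = ⟨u, Tt g⟩`. -/
def IsWeylQuantization {d : ℕ} (a : PhaseSpace d → ℂ)
    (A : 𝓢'(Rd d, ℂ) →L[ℂ] 𝓢'(Rd d, ℂ)) : Prop :=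
  ∃ T Tt : 𝓢(Rd d, ℂ) →L[ℂ] 𝓢(Rd d, ℂ),
    (∀ (g : 𝓢(Rd d, ℂ)) (x : Rd d), T g x = weylIntegral a g x) ∧
    (∀ f g : 𝓢(Rd d, ℂ), ∫ x, T f x * g x = ∫ x, f x * Tt g x) ∧
    ∀ (u : 𝓢'(Rd d, ℂ)) (g : 𝓢(Rd d, ℂ)), A u g = u (Tt g)

/-- There is at most one operator `a^w(x,D)` on `𝓢'(ℝ^d)`. -/
theorem IsWeylQuantization.unique {d : ℕ} {a : PhaseSpace d → ℂ}
    {A B : 𝓢'(Rd d, ℂ) →L[ℂ] 𝓢'(Rd d, ℂ)}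
    (hA : IsWeylQuantization a A) (hB : IsWeylQuantization a B) : A = B := by
  obtain ⟨T, Tt, hT, hTt, hA⟩ := hA
  obtain ⟨S, St, hS, hSt, hB⟩ := hB
  have hTS : T = S := by
    ext g x
    rw [hT, hS]
  subst hTS
  have key : ∀ g, Tt g = St g := by
    intro g
    apply SchwartzMap.injective_toLp 2 (volume : Measure (Rd d))
    apply LinearMap.ker_eq_bot.mp
      (Lp.ker_toTemperedDistributionCLM_eq_bot (F := ℂ) (μ := (volume : Measure (Rd d))) (p := 2))
    simp only [ContinuousLinearMap.coe_coe, Lp.toTemperedDistributionCLM_apply,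
      Lp.toTemperedDistribution_toLp_eq]
    ext f
    simp only [SchwartzMap.toTemperedDistributionCLM_apply_apply, smul_eq_mul]
    rw [← hTt, ← hSt]
  ext u g
  rw [hA, hB, key]

open Classical in
/-- The operator `a^w(x,D) : 𝓢'(ℝ^d) → 𝓢'(ℝ^d)`, with the convention that it is `0` for those `a`
for which there is no such operator. -/
def weylOp {d : ℕ} (a : PhaseSpace d → ℂ) : 𝓢'(Rd d, ℂ) →L[ℂ] 𝓢'(Rd d, ℂ) :=
  if H : ∃ A, IsWeylQuantization a A then H.choose else 0

/-- `weylOp a` is the Weyl quantization of `a` as soon as there is one. -/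
theorem IsWeylQuantization.weylOp_eq {d : ℕ} {a : PhaseSpace d → ℂ}
    {A : 𝓢'(Rd d, ℂ) →L[ℂ] 𝓢'(Rd d, ℂ)} (hA : IsWeylQuantization a A) : weylOp a = A := by
  have H : ∃ A, IsWeylQuantization a A := ⟨A, hA⟩
  rw [weylOp, dif_pos H]
  exact H.choose_spec.unique hA

end

/-! A negligible symbol is, at each fixed `h`, a Schwartz function on phase space, and all its
Schwartz seminorms are `O(h^N)` for every `N`: writing `a = h^(k+N) b`, the factor `h^k` turns
`|z|^k` into `(h|z|)^k`, which the decay of `b` in `⟨hz⟩` absorbs (`IsNegligibleSymbol.decay`). It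
remains to bound the `L²` norm of `b^w u`, for `b` Schwartz and `u` fixed, by one seminorm of `b`.

For this, the kernel of `b^w` is a partial Fourier transform of `b`, hence rapidly decreasing in
both variables with constants linear in a seminorm of `b` (`norm_weylKernel_le`). An `x`-derivative
of `b^w g` is the same kind of operator with another Schwartz symbol (`hasFDerivAt_weylVec`), so
every seminorm of `b^w g` is at most a seminorm of `b` times the `L²` norm of `g`
(`schwartzSup_weylCLM_le`). The transpose of `b^w` has symbol `b(x, -ξ)`, and `u` is bounded by a
single seminorm; hence `g ↦ ⟨b^w u, g⟩` is bounded in the `L²` norm of `g`, and the Riesz theorem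
gives the `L²` function (`exists_Lp_of_norm_le`). -/

noncomputable section

/-! ### Schwartz seminorms with a single pair of indices -/

section SupSeminorm

variable {E F E' F' : Type*} [NormedAddCommGroup E] [NormedSpace ℝ E] [NormedAddCommGroup F]
  [NormedSpace ℝ F] [NormedAddCommGroup E'] [NormedSpace ℝ E'] [NormedAddCommGroup F']
  [NormedSpace ℝ F']

variable (E F) in
/-- The maximum of the Schwartz seminorms with indices at most `(k, n)`. -/
def schwartzSup (k n : ℕ) : Seminorm ℝ 𝓢(E, F) :=
  (Finset.Iic (k, n)).sup (schwartzSeminormFamily ℝ E F)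

theorem continuous_schwartzSup (k n : ℕ) : Continuous (schwartzSup E F k n) := by
  unfold schwartzSup
  refine Finset.sup_induction (p := fun q : Seminorm ℝ 𝓢(E, F) => Continuous q) ?_ ?_ ?_
  · exact continuous_const
  · intro p hp q hq
    exact hp.sup hq
  · intro m _
    exact (schwartz_withSeminorms ℝ E F).continuous_seminorm m

theorem one_add_norm_pow_mul_le_schwartzSup (k n : ℕ) (f : 𝓢(E, F)) (x : E) :
    (1 + ‖x‖) ^ k * ‖iteratedFDeriv ℝ n f x‖ ≤ 2 ^ k * schwartzSup E F k n f :=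
  SchwartzMap.one_add_le_sup_seminorm_apply (𝕜 := ℝ) (m := (k, n)) le_rfl le_rfl f x

/-- Continuity becomes one explicit inequality, so that constants independent of the symbol can be
carried through compositions. -/
theorem exists_le_schwartzSup_of_continuous (q : Seminorm ℝ 𝓢(E, F)) (hq : Continuous q) :
    ∃ (k n : ℕ) (C : ℝ), 0 ≤ C ∧ ∀ f, q f ≤ C * schwartzSup E F k n f := by
  obtain ⟨s, C, -, h⟩ := Seminorm.bound_of_continuous (schwartz_withSeminorms ℝ E F) q hq
  refine ⟨s.sup Prod.fst, s.sup Prod.snd, C, C.coe_nonneg, fun f => (h f).trans ?_⟩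
  rw [smul_apply, NNReal.smul_def, smul_eq_mul]
  have hs : s ⊆ Finset.Iic (s.sup Prod.fst, s.sup Prod.snd) := fun m hm =>
    Finset.mem_Iic.2 ⟨Finset.le_sup (f := Prod.fst) hm, Finset.le_sup (f := Prod.snd) hm⟩
  exact mul_le_mul_of_nonneg_left (Finset.sup_mono (f := schwartzSeminormFamily ℝ E F) hs f)
    C.coe_nonneg

theorem schwartzSup_clm_le (L : 𝓢(E, F) →L[ℝ] 𝓢(E', F')) (k n : ℕ) :
    ∃ (k' n' : ℕ) (C : ℝ), 0 ≤ C ∧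
      ∀ f, schwartzSup E' F' k n (L f) ≤ C * schwartzSup E F k' n' f :=
  exists_le_schwartzSup_of_continuous ((schwartzSup E' F' k n).comp L.toLinearMap)
    ((continuous_schwartzSup k n).comp L.continuous)

theorem schwartzSup_mono {k n k' n' : ℕ} (hk : k ≤ k') (hn : n ≤ n') (f : 𝓢(E, F)) :
    schwartzSup E F k n f ≤ schwartzSup E F k' n' f :=
  Finset.sup_mono (f := schwartzSeminormFamily ℝ E F)
    (Finset.Iic_subset_Iic.2 (Prod.mk_le_mk.2 ⟨hk, hn⟩)) f

end SupSeminorm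

/-! ### An integrable polynomial weight -/

section Weight

variable {V : Type*} [NormedAddCommGroup V] [NormedSpace ℝ V] [FiniteDimensional ℝ V]
  [MeasurableSpace V] [BorelSpace V] (μ : Measure V) [μ.IsAddHaarMeasure]

theorem integrable_one_add_norm_pow_inv :
    Integrable (fun x : V => ((1 + ‖x‖) ^ (Module.finrank ℝ V + 1))⁻¹) μ := by
  have := integrable_one_add_norm (μ := μ) (E := V) (r := (Module.finrank ℝ V + 1 : ℕ))
    (by push_cast; linarith)
  refine this.congr (Filter.Eventually.of_forall fun x => ?_)
  simp only
  rw [Real.rpow_neg (by positivity), Real.rpow_natCast]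

theorem memLp_two_one_add_norm_pow_inv :
    MemLp (fun x : V => ((1 + ‖x‖) ^ (Module.finrank ℝ V + 1))⁻¹) 2 μ := by
  rw [memLp_two_iff_integrable_sq (by fun_prop)]
  refine (integrable_one_add_norm_pow_inv μ).mono' (by fun_prop)
    (Filter.Eventually.of_forall fun x => ?_)
  rw [Real.norm_of_nonneg (by positivity)]
  have : ((1 + ‖x‖) ^ (Module.finrank ℝ V + 1))⁻¹ ≤ 1 :=
    inv_le_one_of_one_le₀ (one_le_pow₀ (by linarith [norm_nonneg x]))
  have h0 : 0 ≤ ((1 + ‖x‖) ^ (Module.finrank ℝ V + 1))⁻¹ := by positivity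
  nlinarith

/-- Cauchy–Schwarz against a square-integrable weight. This is where the `L²` norm of `g` enters in
place of its Schwartz seminorms. -/
theorem integral_weight_mul_norm_le :
    ∃ C : ℝ, 0 ≤ C ∧ ∀ g : 𝓢(V, ℂ),
      ∫ x, ((1 + ‖x‖) ^ (Module.finrank ℝ V + 1))⁻¹ * ‖g x‖ ∂μ ≤ C * ‖g.toLp 2 μ‖ := by
  refine ⟨(∫ x : V, (((1 + ‖x‖) ^ (Module.finrank ℝ V + 1))⁻¹) ^ (2 : ℝ) ∂μ) ^ (1 / 2 : ℝ),
    by positivity, fun g => ?_⟩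
  have h2 : ENNReal.ofReal 2 = 2 := by norm_num
  have := integral_mul_le_Lp_mul_Lq_of_nonneg (μ := μ) Real.HolderConjugate.two_two
    (f := fun x : V => ((1 + ‖x‖) ^ (Module.finrank ℝ V + 1))⁻¹) (g := fun x => ‖g x‖)
    (Filter.Eventually.of_forall fun x => by simp only [Pi.zero_apply]; positivity)
    (Filter.Eventually.of_forall fun x => norm_nonneg _)
    (by rw [h2]; exact memLp_two_one_add_norm_pow_inv μ)
    (by rw [h2]; exact (g.memLp 2 μ).norm)
  refine this.trans_eq ?_
  rw [SchwartzMap.norm_toLp' (by simp) (by simp)]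
  simp

theorem integrable_weight_mul_norm (g : 𝓢(V, ℂ)) :
    Integrable (fun x => ((1 + ‖x‖) ^ (Module.finrank ℝ V + 1))⁻¹ * ‖g x‖) μ :=
  (memLp_two_one_add_norm_pow_inv μ).integrable_mul ((g.memLp 2 μ).norm)

end Weight

/-! ### Slices of Schwartz functions at a fixed position -/

section Slice

variable {V W G : Type*} [NormedAddCommGroup V] [NormedSpace ℝ V] [NormedAddCommGroup W]
  [NormedSpace ℝ W] [NormedAddCommGroup G] [NormedSpace ℝ G]

theorem norm_iteratedFDeriv_slice_le (b : 𝓢(V × W, G)) (w : V) (n : ℕ) (ξ : W) :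
    ‖iteratedFDeriv ℝ n (fun η => b (w, η)) ξ‖ ≤ ‖iteratedFDeriv ℝ n b (w, ξ)‖ := by
  have h1 : (fun η => b (w, η)) =
      (fun z => b (z + (w, 0))) ∘ (ContinuousLinearMap.inr ℝ V W) := by
    ext η; simp
  have hsm : ContDiff ℝ ∞ (fun z => b (z + (w, 0))) :=
    (b.smooth ⊤).comp (contDiff_id.add contDiff_const)
  rw [h1, ContinuousLinearMap.iteratedFDeriv_comp_right _ hsm _ (mod_cast le_top),
    iteratedFDeriv_comp_add_right]
  refine (ContinuousMultilinearMap.norm_compContinuousLinearMap_le _ _).trans ?_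
  simp only [ContinuousLinearMap.inr_apply, Prod.mk_add_mk, zero_add, add_zero]
  refine mul_le_of_le_one_right (norm_nonneg _) (Finset.prod_le_one (fun _ _ => norm_nonneg _) ?_)
  intro i _
  exact ContinuousLinearMap.norm_inr_le_one ℝ V W

/-- The decay of `b` is split between the two variables: `m` powers are kept for `w`, and `M` powers
are spent on integrability in `ξ`. -/
theorem slice_weight_bound (b : 𝓢(V × W, G)) (m n M : ℕ) (w : V) (ξ : W) :
    (1 + ‖w‖) ^ m * ‖iteratedFDeriv ℝ n (fun η => b (w, η)) ξ‖ ≤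
      2 ^ (m + M) * schwartzSup (V × W) G (m + M) n b * ((1 + ‖ξ‖) ^ M)⁻¹ := by
  rw [← div_eq_mul_inv, le_div_iff₀ (by positivity)]
  calc (1 + ‖w‖) ^ m * ‖iteratedFDeriv ℝ n (fun η => b (w, η)) ξ‖ * (1 + ‖ξ‖) ^ M
      ≤ (1 + ‖(w, ξ)‖) ^ m * ‖iteratedFDeriv ℝ n b (w, ξ)‖ * (1 + ‖(w, ξ)‖) ^ M := by
        gcongr
        · exact norm_fst_le (w, ξ)
        · exact norm_iteratedFDeriv_slice_le b w n ξ
        · exact norm_snd_le (w, ξ)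
    _ = (1 + ‖(w, ξ)‖) ^ (m + M) * ‖iteratedFDeriv ℝ n b (w, ξ)‖ := by ring
    _ ≤ _ := one_add_norm_pow_mul_le_schwartzSup _ _ _ _

theorem norm_apply_le_weight (b : 𝓢(V × W, G)) (M : ℕ) (w : V) (ξ : W) :
    ‖b (w, ξ)‖ ≤ 2 ^ M * schwartzSup (V × W) G M 0 b * ((1 + ‖ξ‖) ^ M)⁻¹ := by
  simpa using slice_weight_bound b 0 0 M w ξ

end Slice


/-! ### Decay of the Weyl kernel -/

section Kernel

open scoped FourierTransform

variable {V G : Type*} [NormedAddCommGroup V] [InnerProductSpace ℝ V] [FiniteDimensional ℝ V]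
  [MeasurableSpace V] [BorelSpace V] [NormedAddCommGroup G] [NormedSpace ℂ G]

/-- The partial Fourier integral `∫ e^{i⟨v,ξ⟩} b(w, ξ) dξ`. -/
def partialFourier (b : V × V → G) (w v : V) : G :=
  ∫ ξ : V, Complex.exp (Complex.I * ((⟪v, ξ⟫_ℝ : ℝ) : ℂ)) • b (w, ξ)

/-- The Schwartz kernel of the Weyl quantization of `b`, up to the factor `(2π)^d`. -/
def weylKernel (b : V × V → G) (x y : V) : G :=
  partialFourier b ((2⁻¹ : ℝ) • (x + y)) (x - y)

theorem norm_exp_I_mul_ofReal_smul (t : ℝ) (c : G) :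
    ‖Complex.exp (Complex.I * (t : ℂ)) • c‖ = ‖c‖ := by
  rw [norm_smul, mul_comm Complex.I, Complex.norm_exp_ofReal_mul_I, one_mul]

theorem partialFourier_eq_fourier (b : V × V → G) (w v : V) :
    partialFourier b w v = 𝓕 (fun ξ => b (w, ξ)) ((-(2 * Real.pi)⁻¹ : ℝ) • v) := by
  rw [Real.fourier_eq', partialFourier]
  congr 1 with ξ
  congr 2
  rw [inner_smul_right, real_inner_comm]
  have : (-2 * Real.pi * (-(2 * Real.pi)⁻¹ * ⟪ξ, v⟫_ℝ)) = ⟪ξ, v⟫_ℝ := by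
    have := Real.pi_ne_zero
    field_simp
  rw [this, mul_comm]

theorem integrable_iteratedFDeriv_slice (b : 𝓢(V × V, G)) (n : ℕ) (w : V) :
    Integrable (fun ξ => ‖iteratedFDeriv ℝ n (fun η => b (w, η)) ξ‖) := by
  have hsm : ContDiff ℝ ∞ (fun η => b (w, η)) :=
    (b.smooth ⊤).comp (contDiff_const.prodMk contDiff_id)
  refine ((integrable_one_add_norm_pow_inv (volume : Measure V)).const_mul
    (2 ^ (0 + (Module.finrank ℝ V + 1)) *
      schwartzSup (V × V) G (0 + (Module.finrank ℝ V + 1)) n b)).mono' ?_ ?_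
  · exact (hsm.continuous_iteratedFDeriv (mod_cast le_top)).norm.aestronglyMeasurable
  · refine Filter.Eventually.of_forall fun ξ => ?_
    rw [norm_norm]
    simpa using slice_weight_bound b 0 n (Module.finrank ℝ V + 1) w ξ

theorem integral_iteratedFDeriv_slice_le (m n : ℕ) :
    ∃ (k : ℕ) (C : ℝ), 0 ≤ C ∧ ∀ (b : 𝓢(V × V, G)) (w : V),
      (1 + ‖w‖) ^ m * ∫ ξ, ‖iteratedFDeriv ℝ n (fun η => b (w, η)) ξ‖ ≤
        C * schwartzSup (V × V) G k n b := by
  refine ⟨m + (Module.finrank ℝ V + 1), 2 ^ (m + (Module.finrank ℝ V + 1)) *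
    ∫ ξ : V, ((1 + ‖ξ‖) ^ (Module.finrank ℝ V + 1))⁻¹, by positivity, fun b w => ?_⟩
  rw [← integral_const_mul, mul_right_comm, ← integral_const_mul]
  refine integral_mono ((integrable_iteratedFDeriv_slice b n w).const_mul _)
    ((integrable_one_add_norm_pow_inv (volume : Measure V)).const_mul _) fun ξ => ?_
  exact slice_weight_bound b m n (Module.finrank ℝ V + 1) w ξ

/-- Integration by parts in `ξ`: powers of `v` cost derivatives of the slice, while the weight in
`w` passes through the integral. -/
theorem norm_pow_mul_partialFourier_le (m n : ℕ) :
    ∃ (k n' : ℕ) (C : ℝ), 0 ≤ C ∧ ∀ (b : 𝓢(V × V, G)) (w v : V),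
      (1 + ‖w‖) ^ m * (‖v‖ ^ n * ‖partialFourier b w v‖) ≤ C * schwartzSup (V × V) G k n' b := by
  choose K c hc hK using fun p => integral_iteratedFDeriv_slice_le (V := V) (G := G) m p
  refine ⟨(Finset.range (n + 1)).sup K, n,
    (2 * Real.pi) ^ n * (2 ^ n * ∑ p ∈ Finset.range (n + 1), c p),
    by have := Finset.sum_nonneg (fun p (_ : p ∈ Finset.range (n + 1)) => hc p); positivity,
    fun b w v => ?_⟩
  have hsm : ContDiff ℝ (⊤ : ℕ∞) (fun η => b (w, η)) :=
    (b.smooth ⊤).comp (contDiff_const.prodMk contDiff_id)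
  -- With `K = 0` the transform is not differentiated, so only `L¹` norms of slice derivatives
  -- occur, without moments in `ξ`. The point `-v/(2π)` accounts for the normalization of `𝓕`.
  have key := Real.pow_mul_norm_iteratedFDeriv_fourier_le (K := 0) (N := ⊤) hsm
    (fun k p hk _ => by
      have : k = 0 := by simpa using hk
      subst this
      simpa using integrable_iteratedFDeriv_slice b p w) (k := 0) (n := n) le_rfl le_top
      ((-(2 * Real.pi)⁻¹ : ℝ) • v)
  rw [norm_iteratedFDeriv_zero, ← partialFourier_eq_fourier, norm_smul, norm_neg,
    Real.norm_of_nonneg (by positivity), mul_pow, inv_pow, mul_assoc,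
    inv_mul_le_iff₀ (by positivity)] at key
  simp only [zero_add, Finset.range_one, Finset.singleton_product, Finset.sum_map,
    Function.Embedding.coeFn_mk, pow_zero, one_mul, Nat.cast_zero, mul_zero] at key
  calc (1 + ‖w‖) ^ m * (‖v‖ ^ n * ‖partialFourier b w v‖)
      ≤ (1 + ‖w‖) ^ m * ((2 * Real.pi) ^ n * (2 ^ n * ∑ p ∈ Finset.range (n + 1),
          ∫ ξ, ‖iteratedFDeriv ℝ p (fun η => b (w, η)) ξ‖)) := by gcongr
    _ = (2 * Real.pi) ^ n * (2 ^ n * ∑ p ∈ Finset.range (n + 1),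
          (1 + ‖w‖) ^ m * ∫ ξ, ‖iteratedFDeriv ℝ p (fun η => b (w, η)) ξ‖) := by
        rw [← Finset.mul_sum]; ring
    _ ≤ (2 * Real.pi) ^ n * (2 ^ n * ∑ p ∈ Finset.range (n + 1),
          c p * schwartzSup (V × V) G ((Finset.range (n + 1)).sup K) n b) := by
        refine mul_le_mul_of_nonneg_left (mul_le_mul_of_nonneg_left
          (Finset.sum_le_sum fun p hp => ?_) (by positivity)) (by positivity)
        refine (hK p b w).trans (mul_le_mul_of_nonneg_left ?_ (hc p))
        exact schwartzSup_mono (Finset.le_sup hp) (Finset.mem_range_succ_iff.1 hp) b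
    _ = _ := by rw [← Finset.sum_mul]; ring

theorem one_add_norm_pow_mul_partialFourier_le (m n : ℕ) :
    ∃ (k n' : ℕ) (C : ℝ), 0 ≤ C ∧ ∀ (b : 𝓢(V × V, G)) (w v : V),
      (1 + ‖w‖) ^ m * ((1 + ‖v‖) ^ n * ‖partialFourier b w v‖) ≤
        C * schwartzSup (V × V) G k n' b := by
  obtain ⟨k₀, n₀, C₀, hC₀, h₀⟩ := norm_pow_mul_partialFourier_le (V := V) (G := G) m 0
  obtain ⟨k₁, n₁, C₁, hC₁, h₁⟩ := norm_pow_mul_partialFourier_le (V := V) (G := G) m n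
  refine ⟨max k₀ k₁, max n₀ n₁, 2 ^ n * (C₀ + C₁), by positivity, fun b w v => ?_⟩
  have hpow : (1 + ‖v‖) ^ n ≤ 2 ^ n * (1 + ‖v‖ ^ n) := by
    have := add_pow_le (zero_le_one (α := ℝ)) (norm_nonneg v) n
    rw [one_pow] at this
    refine this.trans (mul_le_mul_of_nonneg_right ?_ (by positivity))
    exact pow_le_pow_right₀ one_le_two (Nat.sub_le n 1)
  calc (1 + ‖w‖) ^ m * ((1 + ‖v‖) ^ n * ‖partialFourier b w v‖)
      ≤ (1 + ‖w‖) ^ m * ((2 ^ n * (1 + ‖v‖ ^ n)) * ‖partialFourier b w v‖) := by gcongr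
    _ = 2 ^ n * ((1 + ‖w‖) ^ m * (‖v‖ ^ 0 * ‖partialFourier b w v‖) +
          (1 + ‖w‖) ^ m * (‖v‖ ^ n * ‖partialFourier b w v‖)) := by ring
    _ ≤ 2 ^ n * (C₀ * schwartzSup (V × V) G (max k₀ k₁) (max n₀ n₁) b +
          C₁ * schwartzSup (V × V) G (max k₀ k₁) (max n₀ n₁) b) := by
        refine mul_le_mul_of_nonneg_left (add_le_add ?_ ?_) (by positivity)
        · exact (h₀ b w v).trans (mul_le_mul_of_nonneg_left
            (schwartzSup_mono (le_max_left _ _) (le_max_left _ _) b) hC₀)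
        · exact (h₁ b w v).trans (mul_le_mul_of_nonneg_left
            (schwartzSup_mono (le_max_right _ _) (le_max_right _ _) b) hC₁)
    _ = _ := by ring

/-- With midpoint `w` and difference `v`, both `1 + ‖x‖` and `1 + ‖y‖` are at most `(1 + ‖w‖)(1 +
‖v‖)`; hence the exponent `m + n` for each of `w` and `v`. -/
theorem norm_weylKernel_le (m n : ℕ) :
    ∃ (k n' : ℕ) (C : ℝ), 0 ≤ C ∧ ∀ (b : 𝓢(V × V, G)) (x y : V),
      (1 + ‖x‖) ^ m * ((1 + ‖y‖) ^ n * ‖weylKernel b x y‖) ≤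
        C * schwartzSup (V × V) G k n' b := by
  obtain ⟨k, n', C, hC, h⟩ :=
    one_add_norm_pow_mul_partialFourier_le (V := V) (G := G) (m + n) (m + n)
  refine ⟨k, n', C, hC, fun b x y => le_trans ?_ (h b ((2⁻¹ : ℝ) • (x + y)) (x - y))⟩
  set w := (2⁻¹ : ℝ) • (x + y) with hw
  set v := x - y with hv
  have hx : x = w + (2⁻¹ : ℝ) • v := by rw [hw, hv]; module
  have hy : y = w - (2⁻¹ : ℝ) • v := by rw [hw, hv]; module
  have h2 : ‖(2⁻¹ : ℝ) • v‖ ≤ ‖v‖ := by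
    rw [norm_smul, Real.norm_of_nonneg (by norm_num)]
    linarith [norm_nonneg v]
  have hwv : 0 ≤ ‖w‖ * ‖v‖ := by positivity
  have hx' : 1 + ‖x‖ ≤ (1 + ‖w‖) * (1 + ‖v‖) := by
    have := norm_add_le w ((2⁻¹ : ℝ) • v)
    rw [← hx] at this
    linarith
  have hy' : 1 + ‖y‖ ≤ (1 + ‖w‖) * (1 + ‖v‖) := by
    have := norm_sub_le w ((2⁻¹ : ℝ) • v)
    rw [← hy] at this
    linarith
  calc (1 + ‖x‖) ^ m * ((1 + ‖y‖) ^ n * ‖weylKernel b x y‖)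
      ≤ ((1 + ‖w‖) * (1 + ‖v‖)) ^ m * (((1 + ‖w‖) * (1 + ‖v‖)) ^ n * ‖weylKernel b x y‖) := by
        gcongr
    _ = (1 + ‖w‖) ^ (m + n) * ((1 + ‖v‖) ^ (m + n) * ‖partialFourier b w v‖) := by
        rw [weylKernel, mul_pow, mul_pow, pow_add, pow_add]; ring

omit [FiniteDimensional ℝ V] [MeasurableSpace V] [BorelSpace V] in
theorem continuous_weylKernel_integrand (b : 𝓢(V × V, G)) :
    Continuous (fun p : (V × V) × V => Complex.exp (Complex.I * ((⟪p.1.1 - p.1.2, p.2⟫_ℝ : ℝ) : ℂ)) •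
      b ((2⁻¹ : ℝ) • (p.1.1 + p.1.2), p.2)) := by
  have := b.continuous
  fun_prop

theorem stronglyMeasurable_weylKernel (b : 𝓢(V × V, G)) :
    StronglyMeasurable (fun p : V × V => weylKernel b p.1 p.2) :=
  (continuous_weylKernel_integrand b).stronglyMeasurable.integral_prod_right

end Kernel


/-! ### The kernel operator and its derivative -/

section KernelOperator

universe u

variable {V G : Type u} [NormedAddCommGroup V] [InnerProductSpace ℝ V] [FiniteDimensional ℝ V]
  [MeasurableSpace V] [BorelSpace V] [NormedAddCommGroup G] [NormedSpace ℂ G]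

/-- The operator with kernel `weylKernel b`. -/
def weylVec (b : V × V → G) (g : V → ℂ) (x : V) : G :=
  ∫ y : V, g y • weylKernel b x y

/-- The integrand of `weylVec b g x` as an integral over phase space. -/
def weylIntegrand (b : V × V → G) (g : V → ℂ) (x : V) (p : V × V) : G :=
  g p.1 • Complex.exp (Complex.I * ((⟪x - p.1, p.2⟫_ℝ : ℝ) : ℂ)) • b ((2⁻¹ : ℝ) • (x + p.1), p.2)

omit [FiniteDimensional ℝ V] [MeasurableSpace V] [BorelSpace V] in
theorem continuous_weylIntegrand (b : 𝓢(V × V, G)) (g : 𝓢(V, ℂ)) (x : V) :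
    Continuous (weylIntegrand b g x) := by
  have := b.continuous
  have := g.continuous
  unfold weylIntegrand
  fun_prop

omit [FiniteDimensional ℝ V] [MeasurableSpace V] [BorelSpace V] in
theorem norm_weylIntegrand_le (b : 𝓢(V × V, G)) (g : 𝓢(V, ℂ)) (x : V) (p : V × V) :
    ‖weylIntegrand b g x p‖ ≤ ‖g p.1‖ *
      (2 ^ (Module.finrank ℝ V + 1) * schwartzSup (V × V) G (Module.finrank ℝ V + 1) 0 b *
        ((1 + ‖p.2‖) ^ (Module.finrank ℝ V + 1))⁻¹) := by
  rw [weylIntegrand, norm_smul, norm_exp_I_mul_ofReal_smul]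
  gcongr
  exact norm_apply_le_weight b _ _ _

theorem integrable_weylIntegrand_bound (b : 𝓢(V × V, G)) (g : 𝓢(V, ℂ)) :
    Integrable (fun p : V × V => ‖g p.1‖ *
      (2 ^ (Module.finrank ℝ V + 1) * schwartzSup (V × V) G (Module.finrank ℝ V + 1) 0 b *
        ((1 + ‖p.2‖) ^ (Module.finrank ℝ V + 1))⁻¹)) ((volume : Measure V).prod volume) :=
  (g.integrable (μ := volume)).norm.mul_prod
    ((integrable_one_add_norm_pow_inv (volume : Measure V)).const_mul _)

theorem integrable_weylIntegrand (b : 𝓢(V × V, G)) (g : 𝓢(V, ℂ)) (x : V) :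
    Integrable (weylIntegrand b g x) ((volume : Measure V).prod volume) :=
  (integrable_weylIntegrand_bound b g).mono' (continuous_weylIntegrand b g x).aestronglyMeasurable
    (Filter.Eventually.of_forall fun p => norm_weylIntegrand_le b g x p)

theorem weylVec_eq_integral_prod (b : 𝓢(V × V, G)) (g : 𝓢(V, ℂ)) (x : V) :
    weylVec b g x = ∫ p, weylIntegrand b g x p ∂((volume : Measure V).prod volume) := by
  rw [integral_prod _ (integrable_weylIntegrand b g x)]
  simp only [weylVec, weylKernel, partialFourier, weylIntegrand, integral_smul]

theorem weylVec_eq_integral_integral (b : 𝓢(V × V, G)) (g : 𝓢(V, ℂ)) (x : V) :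
    weylVec b g x = ∫ ξ : V, ∫ y : V, weylIntegrand b g x (y, ξ) := by
  rw [weylVec_eq_integral_prod, integral_prod_symm _ (integrable_weylIntegrand b g x)]

/-- Differentiating `weylVec b g` amounts to replacing the symbol `b(x, ξ)` by
`½ ∂_x b(x, ξ) + i ξ b(x, ξ)`. -/
def weylDeriv : 𝓢(V × V, G) →L[ℝ] 𝓢(V × V, V →L[ℝ] G) :=
  (SchwartzMap.postcompCLM (𝕜 := ℝ)
      (Complex.I • ContinuousLinearMap.id ℝ (V →L[ℝ] G))).comp
    (SchwartzMap.smulRightCLM ℝ G ((innerSL ℝ).comp (ContinuousLinearMap.snd ℝ V V))) +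
  (SchwartzMap.postcompCLM (𝕜 := ℝ)
      ((2⁻¹ : ℝ) • (ContinuousLinearMap.compL ℝ V (V × V) G).flip
        (ContinuousLinearMap.inl ℝ V V))).comp
    (SchwartzMap.fderivCLM ℝ (V × V) G)

omit [FiniteDimensional ℝ V] [MeasurableSpace V] [BorelSpace V] in
theorem weylDeriv_apply (b : 𝓢(V × V, G)) (z : V × V) (v : V) :
    weylDeriv b z v = Complex.I • (⟪z.2, v⟫_ℝ • b z) + (2⁻¹ : ℝ) • fderiv ℝ b z (v, 0) := by
  simp [weylDeriv]

omit [FiniteDimensional ℝ V] [MeasurableSpace V] [BorelSpace V] in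
theorem hasFDerivAt_weylIntegrand (b : 𝓢(V × V, G)) (g : 𝓢(V, ℂ)) (x : V) (p : V × V) :
    HasFDerivAt (fun x => weylIntegrand b g x p) (weylIntegrand (weylDeriv b) g x p) x := by
  obtain ⟨y, ξ⟩ := p
  have h1 : HasFDerivAt (fun x : V => Complex.I * ((⟪x - y, ξ⟫_ℝ : ℝ) : ℂ))
      (Complex.I • Complex.ofRealCLM.comp (innerSL ℝ ξ)) x := by
    have : HasFDerivAt (fun x : V => (innerSL ℝ ξ) (x - y)) (innerSL ℝ ξ) x :=
      (innerSL ℝ ξ).hasFDerivAt.comp x ((hasFDerivAt_id x).sub_const y)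
    have := (Complex.ofRealCLM.hasFDerivAt.comp x this).const_mul Complex.I
    simpa [Function.comp_def, real_inner_comm] using this
  have h2 : HasFDerivAt (fun x : V => b ((2⁻¹ : ℝ) • (x + y), ξ))
      ((fderiv ℝ b ((2⁻¹ : ℝ) • (x + y), ξ)).comp
        ((2⁻¹ : ℝ) • ContinuousLinearMap.inl ℝ V V)) x := by
    have : HasFDerivAt (fun x : V => ((2⁻¹ : ℝ) • (x + y), ξ))
        ((2⁻¹ : ℝ) • ContinuousLinearMap.inl ℝ V V) x := by
      have h := (((hasFDerivAt_id (𝕜 := ℝ) x).add_const y).const_smul (2⁻¹ : ℝ)).prodMk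
        (hasFDerivAt_const (𝕜 := ℝ) ξ x)
      refine h.congr_fderiv ?_
      ext v <;> simp
    exact (b.hasFDerivAt _).comp x this
  have h3 := (h1.cexp.smul h2).const_smul (g y)
  refine h3.congr_fderiv ?_
  ext v
  simp only [weylIntegrand, smul_apply, weylDeriv_apply]
  simp
  rw [add_comm, mul_smul, mul_smul, Complex.coe_smul]

/-- Differentiation under the phase-space integral; the dominating function does not depend on `x`,
so the whole space serves as neighbourhood. -/
theorem hasFDerivAt_weylVec [CompleteSpace G] (b : 𝓢(V × V, G)) (g : 𝓢(V, ℂ)) (x : V) :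
    HasFDerivAt (weylVec b g) (weylVec (weylDeriv b) g x) x := by
  have h := hasFDerivAt_integral_of_dominated_of_fderiv_le (𝕜 := ℝ)
    (μ := (volume : Measure V).prod volume) (F := weylIntegrand b g)
    (F' := weylIntegrand (weylDeriv b) g) (x₀ := x) Filter.univ_mem
    (Filter.Eventually.of_forall fun x => (continuous_weylIntegrand b g x).aestronglyMeasurable)
    (integrable_weylIntegrand b g x)
    (continuous_weylIntegrand (weylDeriv b) g x).aestronglyMeasurable
    (Filter.Eventually.of_forall fun p x _ => norm_weylIntegrand_le (weylDeriv b) g x p)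
    (integrable_weylIntegrand_bound (weylDeriv b) g)
    (Filter.Eventually.of_forall fun p x _ => hasFDerivAt_weylIntegrand b g x p)
  rw [weylVec_eq_integral_prod (weylDeriv b) g x]
  rwa [show weylVec b g = fun x => ∫ p, weylIntegrand b g x p ∂((volume : Measure V).prod volume)
    from funext fun x => weylVec_eq_integral_prod b g x]

theorem fderiv_weylVec [CompleteSpace G] (b : 𝓢(V × V, G)) (g : 𝓢(V, ℂ)) :
    fderiv ℝ (weylVec b g) = weylVec (weylDeriv b) g :=
  funext fun x => (hasFDerivAt_weylVec b g x).fderiv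

theorem norm_pow_mul_weylVec_le (k : ℕ) :
    ∃ (k' n' : ℕ) (C : ℝ), 0 ≤ C ∧ ∀ (b : 𝓢(V × V, G)) (g : 𝓢(V, ℂ)) (x : V),
      ‖x‖ ^ k * ‖weylVec b g x‖ ≤ C * schwartzSup (V × V) G k' n' b * ‖g.toLp 2‖ := by
  obtain ⟨k', n', C, hC, h⟩ := norm_weylKernel_le (V := V) (G := G) k (Module.finrank ℝ V + 1)
  obtain ⟨D, hD, hg⟩ := integral_weight_mul_norm_le (volume : Measure V)
  refine ⟨k', n', C * D, by positivity, fun b g x => ?_⟩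
  have hS : 0 ≤ schwartzSup (V × V) G k' n' b := apply_nonneg _ _
  calc ‖x‖ ^ k * ‖weylVec b g x‖
      ≤ ‖x‖ ^ k * ∫ y, ‖g y • weylKernel b x y‖ := by
        gcongr
        exact norm_integral_le_integral_norm _
    _ = ∫ y, ‖x‖ ^ k * ‖g y • weylKernel b x y‖ := (integral_const_mul _ _).symm
    _ ≤ ∫ y, C * schwartzSup (V × V) G k' n' b *
          (((1 + ‖y‖) ^ (Module.finrank ℝ V + 1))⁻¹ * ‖g y‖) := by
        refine integral_mono_of_nonneg (Filter.Eventually.of_forall fun y => by positivity)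
          ((integrable_weight_mul_norm (volume : Measure V) g).const_mul _)
          (Filter.Eventually.of_forall fun y => ?_)
        have hy := h b x y
        have hx : ‖x‖ ^ k ≤ (1 + ‖x‖) ^ k := by gcongr; linarith
        simp only [norm_smul]
        calc ‖x‖ ^ k * (‖g y‖ * ‖weylKernel b x y‖)
            ≤ (1 + ‖x‖) ^ k * (‖g y‖ * ‖weylKernel b x y‖) := by gcongr
          _ = (1 + ‖x‖) ^ k * ((1 + ‖y‖) ^ (Module.finrank ℝ V + 1) * ‖weylKernel b x y‖) *
                (((1 + ‖y‖) ^ (Module.finrank ℝ V + 1))⁻¹ * ‖g y‖) := by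
              field_simp
          _ ≤ _ := by gcongr
    _ = C * schwartzSup (V × V) G k' n' b *
          ∫ y, ((1 + ‖y‖) ^ (Module.finrank ℝ V + 1))⁻¹ * ‖g y‖ := integral_const_mul _ _
    _ ≤ C * schwartzSup (V × V) G k' n' b * (D * ‖g.toLp 2‖) := by gcongr; exact hg g
    _ = _ := by ring

end KernelOperator

/-! ### Smoothness and bounds on all derivatives -/

section Smoothness

universe u

variable {V : Type u} [NormedAddCommGroup V] [InnerProductSpace ℝ V] [FiniteDimensional ℝ V]
  [MeasurableSpace V] [BorelSpace V]

/-- Each derivative replaces the target `G` by `V →L[ℝ] G`, so the induction must run over all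
targets at once. The common universe of `V` and `G` keeps the new target in range. -/
theorem contDiff_weylVec_nat (n : ℕ) : ∀ {G : Type u} [NormedAddCommGroup G] [NormedSpace ℂ G]
    [CompleteSpace G] (b : 𝓢(V × V, G)) (g : 𝓢(V, ℂ)), ContDiff ℝ n (weylVec b g) := by
  induction n with
  | zero =>
    intro G _ _ _ b g
    refine contDiff_zero.2 (continuous_iff_continuousAt.2 fun x => ?_)
    exact (hasFDerivAt_weylVec b g x).continuousAt
  | succ n ih =>
    intro G _ _ _ b g
    rw [Nat.cast_succ, contDiff_succ_iff_fderiv]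
    refine ⟨fun x => (hasFDerivAt_weylVec b g x).differentiableAt, by simp, ?_⟩
    rw [fderiv_weylVec]
    exact ih _ _

theorem contDiff_weylVec {G : Type u} [NormedAddCommGroup G] [NormedSpace ℂ G]
    [CompleteSpace G] (b : 𝓢(V × V, G)) (g : 𝓢(V, ℂ)) : ContDiff ℝ ∞ (weylVec b g) :=
  contDiff_infty.2 fun n => contDiff_weylVec_nat n b g

theorem norm_pow_mul_iteratedFDeriv_weylVec_le (k n : ℕ) :
    ∀ {G : Type u} [NormedAddCommGroup G] [NormedSpace ℂ G] [CompleteSpace G],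
    ∃ (k' n' : ℕ) (C : ℝ), 0 ≤ C ∧ ∀ (b : 𝓢(V × V, G)) (g : 𝓢(V, ℂ)) (x : V),
      ‖x‖ ^ k * ‖iteratedFDeriv ℝ n (weylVec b g) x‖ ≤
        C * schwartzSup (V × V) G k' n' b * ‖g.toLp 2‖ := by
  induction n with
  | zero =>
    intro G _ _ _
    simpa only [norm_iteratedFDeriv_zero] using norm_pow_mul_weylVec_le (V := V) (G := G) k
  | succ n ih =>
    intro G _ _ _
    obtain ⟨k₁, n₁, C₁, hC₁, h₁⟩ := ih (G := V →L[ℝ] G)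
    obtain ⟨k₂, n₂, C₂, hC₂, h₂⟩ := schwartzSup_clm_le (weylDeriv (V := V) (G := G)) k₁ n₁
    refine ⟨k₂, n₂, C₁ * C₂, by positivity, fun b g x => ?_⟩
    rw [← norm_iteratedFDeriv_fderiv, fderiv_weylVec]
    refine (h₁ (weylDeriv b) g x).trans ?_
    rw [mul_assoc C₁ C₂]
    gcongr
    exact h₂ b

end Smoothness


/-! ### Weyl operators on Schwartz functions and their transposes -/

section SchwartzOperator

variable {V : Type} [NormedAddCommGroup V] [InnerProductSpace ℝ V] [FiniteDimensional ℝ V]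
  [MeasurableSpace V] [BorelSpace V]

theorem weylVec_add (b : 𝓢(V × V, ℂ)) (f g : 𝓢(V, ℂ)) (x : V) :
    weylVec b (f + g : 𝓢(V, ℂ)) x = weylVec b f x + weylVec b g x := by
  simp only [weylVec_eq_integral_prod]
  rw [← integral_add (integrable_weylIntegrand b f x) (integrable_weylIntegrand b g x)]
  simp only [weylIntegrand, add_apply, add_smul]

theorem weylVec_smul (b : 𝓢(V × V, ℂ)) (c : ℂ) (g : 𝓢(V, ℂ)) (x : V) :
    weylVec b (c • g : 𝓢(V, ℂ)) x = c • weylVec b g x := by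
  simp only [weylVec, smul_apply, smul_assoc, integral_smul]

/-- The Weyl quantization of a Schwartz symbol, up to the factor `(2π)^d`, as an operator on
Schwartz functions. -/
def weylCLM (b : 𝓢(V × V, ℂ)) : 𝓢(V, ℂ) →L[ℂ] 𝓢(V, ℂ) :=
  SchwartzMap.mkCLM (fun g x => weylVec b g x) (fun f g x => weylVec_add b f g x)
    (fun c g x => weylVec_smul b c g x) (fun g => contDiff_weylVec b g) <| by
      rintro ⟨k, n⟩
      obtain ⟨k', n', C, hC, h⟩ :=
        norm_pow_mul_iteratedFDeriv_weylVec_le (V := V) k n (G := ℂ)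
      obtain ⟨k₂, C₂, hC₂, h₂⟩ := SchwartzMap.norm_toLp_le_seminorm ℂ (E := V) ℂ 2
      have hS : 0 ≤ schwartzSup (V × V) ℂ k' n' b := apply_nonneg _ _
      refine ⟨Finset.Iic (k₂, 0), C * schwartzSup (V × V) ℂ k' n' b * C₂, by positivity,
        fun g x => (h b g x).trans ?_⟩
      rw [mul_assoc _ C₂]
      gcongr
      exact h₂ g

theorem weylCLM_apply (b : 𝓢(V × V, ℂ)) (g : 𝓢(V, ℂ)) (x : V) :
    weylCLM b g x = weylVec b g x := rfl

/-- The smoothing estimate: only the `L²` norm of `g` appears, and the dependence on `b` is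
explicit, hence uniform over families of symbols. -/
theorem schwartzSup_weylCLM_le (k n : ℕ) :
    ∃ (k' n' : ℕ) (C : ℝ), 0 ≤ C ∧ ∀ (b : 𝓢(V × V, ℂ)) (g : 𝓢(V, ℂ)),
      schwartzSup V ℂ k n (weylCLM b g) ≤ C * schwartzSup (V × V) ℂ k' n' b * ‖g.toLp 2‖ := by
  choose K N C hC h using fun m : ℕ × ℕ =>
    norm_pow_mul_iteratedFDeriv_weylVec_le (V := V) m.1 m.2 (G := ℂ)
  have hCs : 0 ≤ ∑ m ∈ Finset.Iic (k, n), C m := Finset.sum_nonneg fun m _ => hC m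
  refine ⟨(Finset.Iic (k, n)).sup K, (Finset.Iic (k, n)).sup N, ∑ m ∈ Finset.Iic (k, n), C m,
    hCs, fun b g => ?_⟩
  have hS : 0 ≤ schwartzSup (V × V) ℂ ((Finset.Iic (k, n)).sup K) ((Finset.Iic (k, n)).sup N) b :=
    apply_nonneg _ _
  refine Seminorm.finset_sup_apply_le (by positivity) fun m hm => ?_
  refine SchwartzMap.seminorm_le_bound ℝ _ _ _ (by positivity) fun x => (h m b g x).trans ?_
  have hS' : 0 ≤ schwartzSup (V × V) ℂ (K m) (N m) b := apply_nonneg _ _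
  gcongr
  · exact Finset.single_le_sum (fun m _ => hC m) hm
  · exact schwartzSup_mono (Finset.le_sup hm) (Finset.le_sup hm) b

theorem norm_apply_weylCLM_le (u : 𝓢'(V, ℂ)) :
    ∃ (k n : ℕ) (C : ℝ), 0 ≤ C ∧ ∀ (b : 𝓢(V × V, ℂ)) (g : 𝓢(V, ℂ)),
      ‖u (weylCLM b g)‖ ≤ C * schwartzSup (V × V) ℂ k n b * ‖g.toLp 2‖ := by
  obtain ⟨k, n, C, hC, h⟩ := exists_le_schwartzSup_of_continuous
    ((normSeminorm ℝ ℂ).comp (u.toLinearMap.restrictScalars ℝ))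
    (continuous_norm.comp u.continuous)
  obtain ⟨k', n', D, hD, h'⟩ := schwartzSup_weylCLM_le (V := V) k n
  refine ⟨k', n', C * D, by positivity, fun b g => (h (weylCLM b g)).trans ?_⟩
  rw [mul_assoc, mul_assoc, ← mul_assoc D]
  exact mul_le_mul_of_nonneg_left (h' b g) hC

/-- The symbol `b(x, -ξ)` of the transpose. -/
def reflectSymbol : 𝓢(V × V, ℂ) →L[ℝ] 𝓢(V × V, ℂ) :=
  SchwartzMap.compCLMOfContinuousLinearEquiv ℝ
    ((ContinuousLinearEquiv.refl ℝ V).prodCongr (ContinuousLinearEquiv.neg ℝ))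

omit [FiniteDimensional ℝ V] [MeasurableSpace V] [BorelSpace V] in
theorem reflectSymbol_apply (b : 𝓢(V × V, ℂ)) (x ξ : V) :
    reflectSymbol b (x, ξ) = b (x, -ξ) := rfl

theorem weylKernel_reflectSymbol (b : 𝓢(V × V, ℂ)) (x y : V) :
    weylKernel (reflectSymbol b) x y = weylKernel b y x := by
  -- The substitution `ξ ↦ -ξ` undoes the reflection and changes the sign of `x - y`.
  rw [weylKernel, weylKernel, partialFourier, partialFourier, ← integral_neg_eq_self]
  congr 1 with ξ
  rw [reflectSymbol_apply, neg_neg, inner_neg_right, ← inner_neg_left, neg_sub, add_comm]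

theorem integrable_mul_weylKernel_mul (b : 𝓢(V × V, ℂ)) (f g : 𝓢(V, ℂ)) :
    Integrable (fun p : V × V => f p.2 * weylKernel b p.1 p.2 * g p.1)
      ((volume : Measure V).prod volume) := by
  obtain ⟨k, n, C, -, h⟩ := norm_weylKernel_le (V := V) (G := ℂ) 0 0
  refine (((g.integrable (μ := volume)).norm.mul_prod
    (f.integrable (μ := volume)).norm).mul_const (C * schwartzSup (V × V) ℂ k n b)).mono' ?_ ?_
  · exact (((f.continuous.comp continuous_snd).stronglyMeasurable.mul
      (stronglyMeasurable_weylKernel b)).mul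
      (g.continuous.comp continuous_fst).stronglyMeasurable).aestronglyMeasurable
  · refine Filter.Eventually.of_forall fun p => ?_
    have hp : ‖weylKernel b p.1 p.2‖ ≤ C * schwartzSup (V × V) ℂ k n b := by
      simpa using h b p.1 p.2
    calc ‖f p.2 * weylKernel b p.1 p.2 * g p.1‖
        = ‖g p.1‖ * ‖f p.2‖ * ‖weylKernel b p.1 p.2‖ := by rw [norm_mul, norm_mul]; ring
      _ ≤ _ := by gcongr

theorem integral_weylCLM_mul (b : 𝓢(V × V, ℂ)) (f g : 𝓢(V, ℂ)) :
    ∫ x, weylCLM b f x * g x = ∫ x, f x * weylCLM (reflectSymbol b) g x := by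
  calc ∫ x, weylCLM b f x * g x
      = ∫ x, ∫ y, f y * weylKernel b x y * g x := by
        simp only [weylCLM_apply, weylVec, smul_eq_mul, integral_mul_const]
    _ = ∫ y, ∫ x, f y * weylKernel b x y * g x :=
        integral_integral_swap (integrable_mul_weylKernel_mul b f g)
    _ = ∫ y, f y * weylCLM (reflectSymbol b) g y := by
        simp only [weylCLM_apply, weylVec, smul_eq_mul, weylKernel_reflectSymbol, mul_assoc,
          integral_const_mul, mul_comm (g _)]

end SchwartzOperator

/-! ### From an `L²` bound to an `L²` function -/

section Riesz

variable {V : Type*} [NormedAddCommGroup V] [InnerProductSpace ℝ V] [FiniteDimensional ℝ V]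
  [MeasurableSpace V] [BorelSpace V]

/-- Schwartz functions are dense in `L²`, so `u` extends to a bounded functional, which Riesz
represents. The distributional pairing is bilinear and the inner product sesquilinear, hence the
conjugate `star f₀`. -/
theorem exists_Lp_of_norm_le (u : 𝓢'(V, ℂ)) {C : ℝ} (hC : 0 ≤ C)
    (h : ∀ g : 𝓢(V, ℂ), ‖u g‖ ≤ C * ‖g.toLp 2‖) :
    ∃ f : Lp ℂ 2 (volume : Measure V), u = Lp.toTemperedDistribution f ∧ ‖f‖ ≤ C := by
  set e : 𝓢(V, ℂ) →ₗ[ℂ] Lp ℂ 2 (volume : Measure V) :=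
    (SchwartzMap.toLpCLM ℂ ℂ 2 (volume : Measure V)).toLinearMap with he
  have hd : DenseRange e :=
    SchwartzMap.denseRange_toLpCLM (F := ℂ) (μ := (volume : Measure V)) (by simp)
  have h' : ∀ g, ‖u.toLinearMap g‖ ≤ C * ‖e g‖ := h
  set φ : Lp ℂ 2 (volume : Measure V) →L[ℂ] ℂ := u.toLinearMap.extendOfNorm e with hφ
  set f₀ := (InnerProductSpace.toDual ℂ (Lp ℂ 2 (volume : Measure V))).symm φ with hf₀
  refine ⟨star f₀, ?_, ?_⟩
  · ext g
    have h1 : u g = φ (g.toLp 2) :=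
      (LinearMap.extendOfNorm_eq (f := u.toLinearMap) (e := e) hd ⟨C, h'⟩ g).symm
    rw [h1, ← InnerProductSpace.toDual_symm_apply, Lp.toTemperedDistribution_apply, L2.inner_def]
    refine integral_congr_ae ?_
    filter_upwards [g.coeFn_toLp 2 volume, Lp.coeFn_star f₀] with x hx hs
    rw [hx, hs]
    simp [RCLike.inner_apply, hf₀]
  · have hstar : ‖star f₀‖ = ‖f₀‖ := by
      rw [Lp.norm_def, Lp.norm_def, eLpNorm_congr_norm_ae (g := f₀)]
      filter_upwards [Lp.coeFn_star f₀] with x hx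
      rw [hx, Pi.star_apply, norm_star]
    rw [hstar, hf₀, LinearIsometryEquiv.norm_map]
    exact LinearMap.opNorm_extendOfNorm_le hd hC h'

end Riesz

/-! ### Weyl quantization of Schwartz symbols on distributions -/

section Weyl

variable {d : ℕ}

theorem weylIntegral_eq (b : 𝓢(PhaseSpace d, ℂ)) (g : 𝓢(Rd d, ℂ)) (x : Rd d) :
    weylIntegral b g x = (((2 * Real.pi) ^ d)⁻¹ : ℝ) * weylCLM b g x := by
  rw [weylIntegral, weylCLM_apply, weylVec_eq_integral_integral]
  congr 1
  refine integral_congr_ae (Filter.Eventually.of_forall fun ξ => ?_)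
  refine integral_congr_ae (Filter.Eventually.of_forall fun y => ?_)
  simp only [weylIntegrand, smul_eq_mul]
  ring

/-- The transpose of the Weyl quantization of a Schwartz symbol. -/
def weylTranspose (b : 𝓢(PhaseSpace d, ℂ)) : 𝓢(Rd d, ℂ) →L[ℂ] 𝓢(Rd d, ℂ) :=
  ((((2 * Real.pi) ^ d)⁻¹ : ℝ) : ℂ) • weylCLM (reflectSymbol b)

theorem isWeylQuantization_schwartz (b : 𝓢(PhaseSpace d, ℂ)) :
    IsWeylQuantization b (PointwiseConvergenceCLM.precomp ℂ (weylTranspose b)) := by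
  refine ⟨((((2 * Real.pi) ^ d)⁻¹ : ℝ) : ℂ) • weylCLM b, weylTranspose b, fun g x => ?_,
    fun f g => ?_, fun u g => rfl⟩
  · rw [weylIntegral_eq]; rfl
  · have := integral_weylCLM_mul b f g
    simp only [weylTranspose, smul_apply, smul_eq_mul]
    simp_rw [mul_left_comm (f _), mul_assoc]
    rw [integral_const_mul, integral_const_mul, this]

theorem exists_Lp_weylOp (u : 𝓢'(Rd d, ℂ)) :
    ∃ (k n : ℕ) (C : ℝ), 0 ≤ C ∧ ∀ b : 𝓢(PhaseSpace d, ℂ),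
      ∃ f : Lp ℂ 2 (volume : Measure (Rd d)), weylOp b u = Lp.toTemperedDistribution f ∧
        ‖f‖ ≤ C * schwartzSup (PhaseSpace d) ℂ k n b := by
  obtain ⟨k₁, n₁, C₁, hC₁, h₁⟩ := norm_apply_weylCLM_le u
  obtain ⟨k, n, C₂, hC₂, h₂⟩ := schwartzSup_clm_le (reflectSymbol (V := Rd d)) k₁ n₁
  refine ⟨k, n, ((2 * Real.pi) ^ d)⁻¹ * (C₁ * C₂), by positivity, fun b => ?_⟩
  have hS : 0 ≤ schwartzSup (PhaseSpace d) ℂ k n b := apply_nonneg _ _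
  refine exists_Lp_of_norm_le _ (by positivity) fun g => ?_
  rw [(isWeylQuantization_schwartz b).weylOp_eq]
  have h0 : (PointwiseConvergenceCLM.precomp ℂ (weylTranspose b) u) g =
      ((((2 * Real.pi) ^ d)⁻¹ : ℝ) : ℂ) * u (weylCLM (reflectSymbol b) g) :=
    map_smul u _ _
  rw [h0, norm_mul, Complex.norm_real, Real.norm_of_nonneg (by positivity), mul_assoc, mul_assoc]
  gcongr
  refine (h₁ _ g).trans ?_
  rw [mul_assoc, mul_assoc, ← mul_assoc C₂]
  gcongr
  exact h₂ b

end Weyl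

/-! ### Negligible symbols as Schwartz functions -/

section Negligible

variable {d : ℕ}

theorem one_le_japBracket (z : PhaseSpace d) : 1 ≤ japBracket z := by
  rw [japBracket, Real.one_le_sqrt]
  nlinarith [sq_nonneg ‖z.1‖, sq_nonneg ‖z.2‖]

theorem norm_le_japBracket (z : PhaseSpace d) : ‖z‖ ≤ japBracket z := by
  refine Real.le_sqrt_of_sq_le ?_
  rw [Prod.norm_def]
  rcases max_cases ‖z.1‖ ‖z.2‖ with ⟨h, -⟩ | ⟨h, -⟩ <;> rw [h] <;>
    nlinarith [sq_nonneg ‖z.1‖, sq_nonneg ‖z.2‖]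

theorem contDiff_of_mem_HShubin {m : ℝ} {b : ℝ → PhaseSpace d → ℂ} (hb : b ∈ HShubin d m) {h : ℝ}
    (hh : h ∈ Ioc (0 : ℝ) 1) : ContDiff ℝ ∞ (b h) := by
  rw [← contDiffOn_univ]
  exact hb.1.comp (f := fun z : PhaseSpace d => (z, h)) (by fun_prop) fun z _ => ⟨mem_univ _, hh⟩

namespace IsNegligibleSymbol

variable {a : ℝ → PhaseSpace d → ℂ}

theorem contDiff (ha : IsNegligibleSymbol a) {h : ℝ} (hh : h ∈ Ioc (0 : ℝ) 1) :
    ContDiff ℝ ∞ (a h) := by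
  obtain ⟨b, hb, hab⟩ := ha 0
  have : a h = b h := funext fun z => by simpa using hab h hh z
  rw [this]
  exact contDiff_of_mem_HShubin hb hh

theorem decay (ha : IsNegligibleSymbol a) (k n N : ℕ) :
    ∃ C : ℝ, 0 ≤ C ∧ ∀ h ∈ Ioc (0 : ℝ) 1, ∀ z : PhaseSpace d,
      ‖z‖ ^ k * ‖iteratedFDeriv ℝ n (a h) z‖ ≤ C * h ^ N := by
  -- Of the `k + N` powers of `h`, `k` are paired with `‖z‖ ^ k` and `N` remain as the gain.
  obtain ⟨b, hb, hab⟩ := ha (k + N)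
  obtain ⟨C, hC⟩ := hb.2 n
  refine ⟨|C|, abs_nonneg C, fun h hh z => ?_⟩
  obtain ⟨h0, h1⟩ := hh
  have hah : a h = ((h : ℂ) ^ (k + N)) • b h := funext fun z => hab h ⟨h0, h1⟩ z
  have hsm := contDiff_of_mem_HShubin hb ⟨h0, h1⟩
  have hJ : 1 ≤ japBracket (h • z) := one_le_japBracket _
  have hz : h * ‖z‖ ≤ japBracket (h • z) := by
    have := norm_le_japBracket (h • z)
    rwa [norm_smul, Real.norm_of_nonneg h0.le] at this
  rw [hah, iteratedFDeriv_const_smul_apply (hsm.contDiffAt.of_le (mod_cast le_top)), norm_smul,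
    norm_pow, Complex.norm_real, Real.norm_of_nonneg h0.le]
  -- Only `k` of the available powers of decay are needed; the bracket is at least `1`, so the
  -- others are dropped.
  have hpow : japBracket (h • z) ^ (-((k + N : ℕ) : ℝ) - n) ≤ (japBracket (h • z) ^ k)⁻¹ := by
    rw [← Real.rpow_natCast, ← Real.rpow_neg (by linarith)]
    refine Real.rpow_le_rpow_of_exponent_le hJ ?_
    push_cast
    have : (0 : ℝ) ≤ N := N.cast_nonneg
    have : (0 : ℝ) ≤ n := n.cast_nonneg
    linarith
  have hb' : ‖iteratedFDeriv ℝ n (b h) z‖ ≤ |C| * (japBracket (h • z) ^ k)⁻¹ := by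
    refine (hC h ⟨h0, h1⟩ z).trans ?_
    have hn : h ^ n ≤ 1 := pow_le_one₀ h0.le h1
    calc C * h ^ n * japBracket (h • z) ^ (-((k + N : ℕ) : ℝ) - n)
        ≤ |C| * 1 * (japBracket (h • z) ^ k)⁻¹ := by
          gcongr
          exact le_abs_self C
      _ = _ := by ring
  calc ‖z‖ ^ k * (h ^ (k + N) * ‖iteratedFDeriv ℝ n (b h) z‖)
      ≤ ‖z‖ ^ k * (h ^ (k + N) * (|C| * (japBracket (h • z) ^ k)⁻¹)) := by gcongr
    _ = |C| * h ^ N * ((h * ‖z‖) ^ k * (japBracket (h • z) ^ k)⁻¹) := by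
        rw [pow_add, mul_pow]; ring
    _ ≤ |C| * h ^ N * 1 := by
        gcongr
        rw [← div_eq_mul_inv]
        exact div_le_one_of_le₀ (by gcongr) (by positivity)
    _ = _ := mul_one _

/-- A negligible symbol at a fixed `h`, as a Schwartz function on phase space. -/
def toSchwartz (ha : IsNegligibleSymbol a) {h : ℝ} (hh : h ∈ Ioc (0 : ℝ) 1) :
    𝓢(PhaseSpace d, ℂ) where
  toFun := a h
  smooth' := ha.contDiff hh
  decay' k n := by
    obtain ⟨C, -, hC⟩ := ha.decay k n 0
    exact ⟨C, fun z => by simpa using hC h hh z⟩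

theorem coe_toSchwartz (ha : IsNegligibleSymbol a) {h : ℝ} (hh : h ∈ Ioc (0 : ℝ) 1) :
    ⇑(ha.toSchwartz hh) = a h := rfl

theorem schwartzSup_toSchwartz_le (ha : IsNegligibleSymbol a) (k n N : ℕ) :
    ∃ C : ℝ, 0 ≤ C ∧ ∀ (h : ℝ) (hh : h ∈ Ioc (0 : ℝ) 1),
      schwartzSup (PhaseSpace d) ℂ k n (ha.toSchwartz hh) ≤ C * h ^ N := by
  choose C hC hle using fun m : ℕ × ℕ => ha.decay m.1 m.2 N
  have hCs : 0 ≤ ∑ m ∈ Finset.Iic (k, n), C m := Finset.sum_nonneg fun m _ => hC m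
  refine ⟨∑ m ∈ Finset.Iic (k, n), C m, hCs, fun h hh => ?_⟩
  have h0 : 0 ≤ h := hh.1.le
  refine Seminorm.finset_sup_apply_le (by positivity) fun m hm => ?_
  refine SchwartzMap.seminorm_le_bound ℝ _ _ _ (by positivity) fun z => (hle m h hh z).trans ?_
  gcongr
  exact Finset.single_le_sum (fun m _ => hC m) hm

end IsNegligibleSymbol

end Negligible

end

theorem propositionA3 (d : ℕ) (u : 𝓢'(Rd d, ℂ)) (a : ℝ → PhaseSpace d → ℂ)
    (ha : IsNegligibleSymbol a) :
    (∀ h ∈ Ioc (0 : ℝ) 1, IsWeylQuantization (a h) (weylOp (a h))) ∧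
    ∀ N : ℕ, ∃ C : ℝ, ∀ h ∈ Ioc (0 : ℝ) 1, ∃ f : Lp ℂ 2 (volume : Measure (Rd d)),
      weylOp (a h) u = Lp.toTemperedDistribution f ∧ ‖f‖ ≤ C * h ^ N := by
  refine ⟨fun h hh => ?_, fun N => ?_⟩
  · have H := isWeylQuantization_schwartz (ha.toSchwartz hh)
    rw [← ha.coe_toSchwartz hh, H.weylOp_eq]
    exact H
  · obtain ⟨k, n, C, hC, H⟩ := exists_Lp_weylOp u
    obtain ⟨D, hD, hle⟩ := ha.schwartzSup_toSchwartz_le k n N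
    refine ⟨C * D, fun h hh => ?_⟩
    obtain ⟨f, hf, hfn⟩ := H (ha.toSchwartz hh)
    refine ⟨f, hf, hfn.trans ?_⟩
    rw [mul_assoc]
    exact mul_le_mul_of_nonneg_left (hle h hh) hC
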